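/- Let $K$ be a field, let $1\le d\le n$ be integers, and let $I\subset S=K[x_1,\dots,x_n]$ be an ideal generated by square-free monomials of degree $\ge d$. Let $\rho_d(I)$ be the number of all square-free monomials of degree $d$ that lie in $I$. If $$\rho_d(I)>\frac{n-d}{n-d+1}\binom{n}{d},$$ then $\operatorname{depth}_S I\le d$, where $\operatorname{depth}_S I$ is the supremum of the lengths of the $I$-regular sequences contained in the maximal ideal $(x_1,\dots,x_n)$ of $S$, with $I$ regarded as an $S$-module. -/

import Mathlib

/-- The square-free monomials of degree `e` in `K[x_1, …, x_n]`: the products of `e` distinct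
variables. -/
def squarefreeMonomials (K : Type*) [Field K] (n e : ℕ) : Set (MvPolynomial (Fin n) K) :=
  {u | ∃ s : Finset (Fin n), s.card = e ∧ u = ∏ i ∈ s, MvPolynomial.X i}

theorem squarefreeMonomials_finite (K : Type*) [Field K] (n e : ℕ) :
    (squarefreeMonomials K n e).Finite :=
  (Set.finite_range (fun s : Finset (Fin n) =>
    ∏ i ∈ s, (MvPolynomial.X i : MvPolynomial (Fin n) K))).subset
    (fun _ ⟨s, _, h⟩ => ⟨s, h.symm⟩)

/-- `I` is generated by square-free monomials of degree at least `d`. -/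
def IsGeneratedBySquarefreeMonomialsOfDegreeGE {K : Type*} [Field K] {n : ℕ}
    (I : Ideal (MvPolynomial (Fin n) K)) (d : ℕ) : Prop :=
  ∃ G : Set (MvPolynomial (Fin n) K),
    (∀ u ∈ G, ∃ e : ℕ, d ≤ e ∧ u ∈ squarefreeMonomials K n e) ∧ I = Ideal.span G

/-- `ρ_d(I)`: the number of all square-free monomials of degree `d` that lie in `I`
(a finite set, by `squarefreeMonomials_finite`). -/
noncomputable def squarefreeMonomialCount {K : Type*} [Field K] {n : ℕ}
    (I : Ideal (MvPolynomial (Fin n) K)) (d : ℕ) : ℕ :=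
  (squarefreeMonomials K n d ∩ (I : Set (MvPolynomial (Fin n) K))).ncard

/-- The depth of a module `M` over `S = K[x_1, …, x_n]`: the supremum of the lengths of the
`M`-regular sequences contained in the maximal ideal `(x_1, …, x_n)`. -/
noncomputable def polyDepth {K : Type*} [Field K] {n : ℕ} (M : Type*) [AddCommGroup M]
    [Module (MvPolynomial (Fin n) K) M] : ℕ∞ :=
  sSup {l : ℕ∞ | ∃ rs : List (MvPolynomial (Fin n) K), (rs.length : ℕ∞) = l ∧
    (∀ r ∈ rs, r ∈ Ideal.span (Set.range (MvPolynomial.X : Fin n → MvPolynomial (Fin n) K))) ∧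
    RingTheory.Sequence.IsRegular M rs}

/-! Put x_σ = ∏_{i ∈ σ} x_i. Double counting shows that fewer than C(n, d-1)/d square-free monomials
of degree d lie outside I. Each of them is divisible by only d square-free monomials of degree d-1,
so some τ with |τ| = d-1 has every x_j x_τ (j ∉ τ) in I
(`Finset.exists_forall_insert_of_card_mul_lt`). The Koszul cochain x_τ e_τ over S then has its
differential in I, giving a d-cocycle with values in I. An I-regular sequence longer than d would
make it the differential of an I-valued cochain
(`RingTheory.Sequence.IsWeaklyRegular.exists_koszulDifferential_eq`). This would write x_{τ ∪ j} as
a combination of products x_i f with f ∈ I. Such products have only terms of degree > d, a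
contradiction. -/

open Finset in
/-- The sign picked up when the basis covector of index `j` is moved past the smaller elements of
`σ`. -/
def koszulSign (R : Type*) [CommRing R] {ι : Type*} [LinearOrder ι] (j : ι) (σ : Finset ι) : R :=
  (-1) ^ (σ.filter (· < j)).card

/-! ### Koszul cochains: wedge, contraction and differential -/

section Koszul

variable {R : Type*} [CommRing R] {ι : Type*} [LinearOrder ι]
  {M : Type*} [AddCommGroup M] [Module R M] {N : Type*} [AddCommGroup N] [Module R N]

theorem koszulSign_mul_self (j : ι) (σ : Finset ι) :
    koszulSign R j σ * koszulSign R j σ = 1 := by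
  rw [koszulSign, ← mul_pow]
  simp

theorem koszulSign_insert {i : ι} (j : ι) {σ : Finset ι} (hi : i ∉ σ) :
    koszulSign R j (insert i σ) = if i < j then -koszulSign R j σ else koszulSign R j σ := by
  unfold koszulSign
  rw [Finset.filter_insert]
  split_ifs with h
  · rw [Finset.card_insert_of_notMem (by simp [hi]), pow_succ]
    ring
  · rfl

theorem koszulSign_erase {i : ι} (j : ι) {σ : Finset ι} (hi : i ∈ σ) :
    koszulSign R j (σ.erase i) = if i < j then -koszulSign R j σ else koszulSign R j σ := by
  have h := koszulSign_insert (R := R) j (Finset.notMem_erase i σ)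
  rw [Finset.insert_erase hi] at h
  split_ifs at h ⊢ <;> simp [h]

/-- Exterior multiplication by the basis covector of index `j`, on Koszul cochains with values
in `M`. -/
def koszulWedge (j : ι) : Module.End R (Finset ι → M) where
  toFun z σ := if j ∈ σ then koszulSign R j σ • z (σ.erase j) else 0
  map_add' z w := by ext σ; by_cases h : j ∈ σ <;> simp [h]
  map_smul' r z := by ext σ; by_cases h : j ∈ σ <;> simp [h, smul_comm r]

/-- Contraction with the basis vector of index `j`. -/
def koszulContract (j : ι) : Module.End R (Finset ι → M) where
  toFun z σ := if j ∈ σ then 0 else koszulSign R j σ • z (insert j σ)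
  map_add' z w := by ext σ; by_cases h : j ∈ σ <;> simp [h]
  map_smul' r z := by ext σ; by_cases h : j ∈ σ <;> simp [h, smul_comm r]

theorem koszulWedge_apply (j : ι) (z : Finset ι → M) (σ : Finset ι) :
    koszulWedge (R := R) j z σ = if j ∈ σ then koszulSign R j σ • z (σ.erase j) else 0 := rfl

theorem koszulContract_apply (j : ι) (z : Finset ι → M) (σ : Finset ι) :
    koszulContract (R := R) j z σ =
      if j ∈ σ then 0 else koszulSign R j σ • z (insert j σ) := rfl

theorem koszulWedge_mul_self (j : ι) :
    (koszulWedge j * koszulWedge j : Module.End R (Finset ι → M)) = 0 := by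
  ext z σ
  simp [koszulWedge_apply]

theorem koszulWedge_anticomm (i j : ι) :
    (koszulWedge i * koszulWedge j + koszulWedge j * koszulWedge i :
      Module.End R (Finset ι → M)) = 0 := by
  refine LinearMap.ext fun z => funext fun σ => ?_
  rcases eq_or_ne i j with rfl | hij
  · simp [koszulWedge_mul_self]
  · simp only [LinearMap.add_apply, Module.End.mul_apply, Pi.add_apply, koszulWedge_apply,
      LinearMap.zero_apply, Pi.zero_apply, Finset.mem_erase]
    by_cases hi : i ∈ σ <;> by_cases hj : j ∈ σ <;> simp only [hi, hj, hij, hij.symm, ne_eq,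
      not_false_eq_true, and_true, and_false, if_true, if_false, smul_zero, add_zero]
    rw [koszulSign_erase j hi, koszulSign_erase i hj, Finset.erase_right_comm]
    rcases lt_or_gt_of_ne hij with h | h
    · simp [h, h.not_gt, smul_smul, mul_comm]
    · simp [h, h.not_gt, smul_smul, mul_comm]

/-- For `i = j` exactly one composite survives at each `σ`, and its two signs cancel. For `i ≠ j`
exactly one of the two orders changes a sign. -/
theorem koszulContract_wedge (i j : ι) :
    (koszulContract i * koszulWedge j + koszulWedge j * koszulContract i :
      Module.End R (Finset ι → M)) = if i = j then 1 else 0 := by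
  refine LinearMap.ext fun z => funext fun σ => ?_
  rcases eq_or_ne i j with rfl | hij
  · simp only [LinearMap.add_apply, Module.End.mul_apply, Pi.add_apply, koszulWedge_apply,
      koszulContract_apply, if_true, Module.End.one_apply]
    by_cases hi : i ∈ σ
    · simp [hi, koszulSign_erase, smul_smul, koszulSign_mul_self]
    · simp [hi, koszulSign_insert, smul_smul, koszulSign_mul_self]
  · simp only [LinearMap.add_apply, Module.End.mul_apply, Pi.add_apply, koszulWedge_apply,
      koszulContract_apply, hij, if_false, LinearMap.zero_apply, Pi.zero_apply, Finset.mem_erase,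
      Finset.mem_insert]
    by_cases hi : i ∈ σ <;> by_cases hj : j ∈ σ <;> simp only [hi, hj, hij, hij.symm, ne_eq,
      not_false_eq_true, and_true, and_false, or_false, or_true, if_true, if_false, smul_zero,
      add_zero]
    rw [koszulSign_erase i hj, koszulSign_insert j hi, Finset.erase_insert_of_ne hij]
    rcases lt_or_gt_of_ne hij with h | h
    · simp [h, h.not_gt, smul_smul, mul_comm]
    · simp [h, h.not_gt, smul_smul, mul_comm]

variable [Fintype ι]

/-- The differential of the Koszul cochain complex of the family `x`. -/
def koszulDifferential (x : ι → R) : Module.End R (Finset ι → M) :=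
  ∑ j, x j • koszulWedge j

theorem koszulDifferential_apply (x : ι → R) (z : Finset ι → M) (σ : Finset ι) :
    koszulDifferential x z σ =
      ∑ j ∈ σ, x j • koszulSign R j σ • z (σ.erase j) := by
  simp [koszulDifferential, koszulWedge_apply]

theorem koszulDifferential_mul_self (x : ι → R) :
    (koszulDifferential x * koszulDifferential x : Module.End R (Finset ι → M)) = 0 := by
  suffices h : ∀ s : Finset ι, ((∑ j ∈ s, x j • koszulWedge j) * (∑ j ∈ s, x j • koszulWedge j) :
      Module.End R (Finset ι → M)) = 0 from h _
  intro s
  induction s using Finset.induction_on with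
  | empty => simp
  | insert a s ha ih =>
    have hcross : ((koszulWedge a) * (∑ j ∈ s, x j • koszulWedge j) +
        (∑ j ∈ s, x j • koszulWedge j) * koszulWedge a : Module.End R (Finset ι → M)) = 0 := by
      rw [Finset.mul_sum, Finset.sum_mul, ← Finset.sum_add_distrib]
      refine Finset.sum_eq_zero fun j _ => ?_
      rw [mul_smul_comm, smul_mul_assoc, ← smul_add, koszulWedge_anticomm, smul_zero]
    rw [Finset.sum_insert ha, add_mul, mul_add, mul_add, ih, smul_mul_smul_comm,
      koszulWedge_mul_self, smul_zero, smul_mul_assoc, mul_smul_comm, add_zero, zero_add,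
      ← smul_add, hcross, smul_zero]

theorem koszulDifferential_differential (x : ι → R) (z : Finset ι → M) :
    koszulDifferential x (koszulDifferential x z) = 0 :=
  LinearMap.congr_fun (koszulDifferential_mul_self x) z

/-- Contraction is a homotopy from multiplication by `x i` to zero, so `x i` kills cohomology. -/
theorem koszulContract_differential (x : ι → R) (i : ι) :
    (koszulContract i * koszulDifferential x + koszulDifferential x * koszulContract i :
      Module.End R (Finset ι → M)) = x i • 1 := by
  simp only [koszulDifferential, Finset.mul_sum, Finset.sum_mul, ← Finset.sum_add_distrib,
    mul_smul_comm, smul_mul_assoc, ← smul_add, koszulContract_wedge]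
  simp

theorem koszulDifferential_map (x : ι → R) (f : M →ₗ[R] N) (z : Finset ι → M) (σ : Finset ι) :
    koszulDifferential x (fun τ => f (z τ)) σ = f (koszulDifferential x z σ) := by
  simp [koszulDifferential_apply]

theorem koszulDifferential_eq_zero_of_card_ne (x : ι → R) {p : ℕ} {z : Finset ι → M}
    (hz : ∀ σ, σ.card ≠ p → z σ = 0) {σ : Finset ι} (hσ : σ.card ≠ p + 1) :
    koszulDifferential x z σ = 0 := by
  rw [koszulDifferential_apply]
  refine Finset.sum_eq_zero fun j hj => ?_
  rw [hz, smul_zero, smul_zero]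
  have := Finset.card_erase_add_one hj
  omega

/-! ### Vanishing of Koszul cohomology -/

/-- The ideal generated by `x` annihilates Koszul cohomology. -/
theorem exists_koszulDifferential_eq_smul (x : ι → R) {r : R}
    (hr : r ∈ Ideal.span (Set.range x)) {p : ℕ} {z : Finset ι → M}
    (hz : ∀ σ, σ.card ≠ p → z σ = 0) (hdz : koszulDifferential x z = 0) :
    ∃ w : Finset ι → M, (∀ σ, σ.card + 1 ≠ p → w σ = 0) ∧ koszulDifferential x w = r • z := by
  obtain ⟨a, rfl⟩ := (Ideal.mem_span_range_iff_exists_fun).1 hr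
  refine ⟨∑ i, a i • koszulContract (R := R) i z, fun σ hσ => ?_, ?_⟩
  · rw [Finset.sum_apply]
    refine Finset.sum_eq_zero fun i _ => ?_
    rw [Pi.smul_apply, koszulContract_apply]
    split_ifs with hi
    · simp
    · rw [hz _ (by rwa [Finset.card_insert_of_notMem hi]), smul_zero, smul_zero]
  · rw [map_sum, Finset.sum_smul]
    refine Finset.sum_congr rfl fun i _ => ?_
    have h := LinearMap.congr_fun (koszulContract_differential (M := M) x i) z
    simp only [LinearMap.add_apply, Module.End.mul_apply, hdz, map_zero, zero_add,
      LinearMap.smul_apply, Module.End.one_apply] at h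
    rw [map_smul, h, smul_smul]

open scoped Pointwise in
/-- Koszul cohomology vanishes in degrees below the length of a weakly regular sequence contained
in the ideal generated by `x`. -/
theorem RingTheory.Sequence.IsWeaklyRegular.exists_koszulDifferential_eq (x : ι → R)
    (rs : List R) (hrs : ∀ r ∈ rs, r ∈ Ideal.span (Set.range x))
    {M : Type*} [AddCommGroup M] [Module R M]
    (hreg : RingTheory.Sequence.IsWeaklyRegular M rs) {p : ℕ} (hp : p < rs.length)
    {z : Finset ι → M} (hz : ∀ σ, σ.card ≠ p → z σ = 0) (hdz : koszulDifferential x z = 0) :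
    ∃ w : Finset ι → M, (∀ σ, σ.card + 1 ≠ p → w σ = 0) ∧ koszulDifferential x w = z := by
  induction hreg using RingTheory.Sequence.IsWeaklyRegular.recIterModByRegular
    generalizing p with
  | nil => simp at hp
  | @cons M _ _ r rs hr _ ih =>
    have hreg : ∀ {a b : Finset ι → _}, r • a = r • b → a = b := fun h =>
      funext fun σ => hr (congrFun h σ)
    obtain ⟨w, hw, hdw⟩ := exists_koszulDifferential_eq_smul x (hrs r (by simp)) hz hdz
    -- No cardinality satisfies `σ.card + 1 = 0`, so in degree zero `w` vanishes.
    cases p with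
    | zero =>
      have hw0 : w = 0 := funext fun σ => hw σ (by omega)
      subst hw0
      refine ⟨0, fun _ _ => rfl, hreg ?_⟩
      rw [← hdw, map_zero, smul_zero]
    | succ p =>
      have hw' : ∀ σ : Finset ι, σ.card ≠ p → w σ = 0 := fun σ hσ => hw σ (by omega)
      have hmk : ∀ m : M, (r • (⊤ : Submodule R M)).mkQ m = 0 → ∃ v, m = r • v := fun m hm => by
        rw [Submodule.mkQ_apply, Submodule.Quotient.mk_eq_zero] at hm
        obtain ⟨v, -, hv⟩ := (Submodule.mem_smul_pointwise_iff_exists _ _ _).1 hm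
        exact ⟨v, hv.symm⟩
      -- Since `dw = r • z`, `w` is a cocycle modulo `r`. Lifting a primitive gives `w = du + r •
      -- v`, hence `r • z = r • dv`, and `r` cancels.
      obtain ⟨u', hu', hdu'⟩ := ih (fun r' hr' => hrs r' (by simp [hr'])) (p := p)
        (by simpa using hp) (z := fun σ => (r • (⊤ : Submodule R M)).mkQ (w σ))
        (fun σ hσ => by rw [hw' σ hσ, map_zero])
        (funext fun σ => by
          rw [koszulDifferential_map, hdw, Pi.smul_apply, Pi.zero_apply, Submodule.mkQ_apply,
            Submodule.Quotient.mk_eq_zero]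
          exact Submodule.smul_mem_pointwise_smul _ _ _ trivial)
      have hlift : ∀ σ, ∃ m : M, (σ.card + 1 ≠ p → m = 0) ∧
          (r • (⊤ : Submodule R M)).mkQ m = u' σ := fun σ => by
        by_cases hσ : σ.card + 1 = p
        · obtain ⟨m, hm⟩ := Submodule.mkQ_surjective _ (u' σ)
          exact ⟨m, fun h => absurd hσ h, hm⟩
        · exact ⟨0, fun _ => rfl, by rw [map_zero, hu' σ hσ]⟩
      choose u hu hmku using hlift
      have hdu : ∀ σ : Finset ι, σ.card ≠ p → koszulDifferential x u σ = 0 := fun σ hσ => by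
        rw [koszulDifferential_apply]
        refine Finset.sum_eq_zero fun j hj => ?_
        have := Finset.card_erase_add_one hj
        rw [hu _ (by omega), smul_zero, smul_zero]
      have hdiv : ∀ σ : Finset ι, ∃ m : M, (σ.card ≠ p → m = 0) ∧
          w σ - koszulDifferential x u σ = r • m := fun σ => by
        by_cases hσ : σ.card = p
        · obtain ⟨v, hv⟩ := hmk (w σ - koszulDifferential x u σ) (by
            rw [map_sub, ← koszulDifferential_map]
            simp only [hmku]
            rw [hdu', sub_self])
          exact ⟨v, fun h => absurd hσ h, hv⟩
        · exact ⟨0, fun _ => rfl, by rw [hw' σ hσ, hdu σ hσ, sub_zero, smul_zero]⟩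
      choose v hv hrv using hdiv
      refine ⟨v, fun σ hσ => hv σ (by omega), hreg ?_⟩
      have hw_eq : w = koszulDifferential x u + r • v := funext fun σ => by
        rw [Pi.add_apply, Pi.smul_apply, ← hrv]
        abel
      rw [← hdw, hw_eq, map_add, koszulDifferential_differential, zero_add, map_smul]

end Koszul

/-! ### Degrees in I and the depth bound -/

section SquarefreeMonomials

variable {K : Type*} [Field K] {n : ℕ}

theorem MvPolynomial.prod_X_eq_monomial (σ : Finset (Fin n)) :
    (∏ i ∈ σ, X i : MvPolynomial (Fin n) K) = monomial (∑ i ∈ σ, Finsupp.single i 1) 1 := by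
  rw [monomial_sum_one]
  rfl

theorem degree_sum_single (σ : Finset (Fin n)) :
    (∑ i ∈ σ, Finsupp.single i 1 : Fin n →₀ ℕ).degree = σ.card := by
  rw [map_sum]
  simp

/-- An ideal generated by monomials of degree at least `d` contains no polynomial with a term of
degree less than `d`. -/
theorem IsGeneratedBySquarefreeMonomialsOfDegreeGE.coeff_eq_zero
    {I : Ideal (MvPolynomial (Fin n) K)} {d : ℕ}
    (hI : IsGeneratedBySquarefreeMonomialsOfDegreeGE I d) {f : MvPolynomial (Fin n) K}
    (hf : f ∈ I) {m : Fin n →₀ ℕ} (hm : m.degree < d) : f.coeff m = 0 := by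
  classical
  obtain ⟨G, hG, rfl⟩ := hI
  induction hf using Submodule.span_induction generalizing m with
  | mem u hu =>
    obtain ⟨e, he, σ, rfl, rfl⟩ := hG u hu
    rw [MvPolynomial.prod_X_eq_monomial, MvPolynomial.coeff_monomial, if_neg]
    rintro rfl
    rw [degree_sum_single] at hm
    omega
  | zero => simp
  | add f g _ _ hf hg => rw [MvPolynomial.coeff_add, hf hm, hg hm, add_zero]
  | smul a f _ hf =>
    rw [smul_eq_mul, MvPolynomial.coeff_mul]
    refine Finset.sum_eq_zero fun q hq => ?_
    have h : q.1.degree + q.2.degree = m.degree := by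
      rw [← map_add, Finset.HasAntidiagonal.mem_antidiagonal.1 hq]
    rw [hf (by omega), mul_zero]

theorem IsGeneratedBySquarefreeMonomialsOfDegreeGE.coeff_X_mul_eq_zero
    {I : Ideal (MvPolynomial (Fin n) K)} {d : ℕ}
    (hI : IsGeneratedBySquarefreeMonomialsOfDegreeGE I d) {f : MvPolynomial (Fin n) K}
    (hf : f ∈ I) (i : Fin n) {m : Fin n →₀ ℕ} (hm : m.degree ≤ d) :
    (MvPolynomial.X i * f).coeff m = 0 := by
  classical
  rw [MvPolynomial.coeff_X_mul']
  split_ifs with hi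
  · have hle : Finsupp.single i 1 ≤ m := by
      rw [Finsupp.single_le_iff]
      exact Nat.one_le_iff_ne_zero.2 (Finsupp.mem_support_iff.1 hi)
    have h : (m - Finsupp.single i 1).degree + 1 = m.degree := by
      conv_rhs => rw [← tsub_add_cancel_of_le hle, map_add, Finsupp.degree_single]
    exact hI.coeff_eq_zero hf (by omega)
  · rfl

/-- If every multiple of degree `d` of a square-free monomial of degree `d - 1` lies in `I`, then
the depth of `I` is at most `d`. -/
theorem polyDepth_le_of_forall_prod_insert_mem
    {I : Ideal (MvPolynomial (Fin n) K)} {d : ℕ}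
    (hI : IsGeneratedBySquarefreeMonomialsOfDegreeGE I d) {τ : Finset (Fin n)}
    (hτ : τ.card + 1 = d) (hdn : d ≤ n)
    (hmem : ∀ j ∉ τ, (∏ i ∈ insert j τ, MvPolynomial.X i) ∈ I) :
    polyDepth (K := K) (n := n) I ≤ (d : ℕ∞) := by
  refine sSup_le ?_
  rintro _ ⟨rs, rfl, hrs, hreg⟩
  by_contra! hlt
  have hlt : d < rs.length := by exact_mod_cast hlt
  let x : Fin n → MvPolynomial (Fin n) K := MvPolynomial.X
  let e : Finset (Fin n) → MvPolynomial (Fin n) K := Pi.single τ (∏ i ∈ τ, x i)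
  have he : ∀ σ, σ ≠ τ → e σ = 0 := fun σ hσ => Pi.single_eq_of_ne hσ _
  -- Only the differential of `e` takes values in `I`; `e` itself does not, since x_τ has degree
  -- d-1.
  have hy : ∀ σ, koszulDifferential x e σ ∈ I := fun σ => by
    rw [koszulDifferential_apply]
    refine sum_mem fun j hj => ?_
    by_cases h : σ.erase j = τ
    · have hjτ : j ∉ τ := h ▸ Finset.notMem_erase j σ
      rw [smul_comm, h, smul_eq_mul, show e τ = ∏ i ∈ τ, x i from Pi.single_eq_same _ _,
        smul_eq_mul, ← Finset.prod_insert hjτ]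
      exact I.mul_mem_left _ (hmem j hjτ)
    · rw [he _ h, smul_zero, smul_zero]
      exact I.zero_mem
  obtain ⟨u, -, hu⟩ := hreg.toIsWeaklyRegular.exists_koszulDifferential_eq x rs hrs hlt
    (z := fun σ => (⟨koszulDifferential x e σ, hy σ⟩ : I))
    (fun σ hσ => Subtype.ext <| koszulDifferential_eq_zero_of_card_ne x (p := τ.card)
      (fun σ' hσ' => he σ' fun h => hσ' (by rw [h])) (by omega))
    (funext fun σ => Subtype.ext <| by
      have h := koszulDifferential_map x I.subtype
        (fun σ => (⟨koszulDifferential x e σ, hy σ⟩ : I)) σ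
      exact h.symm.trans (congrFun (koszulDifferential_differential x e) σ))
  obtain ⟨j, hj⟩ : ∃ j, j ∉ τ := by
    by_contra! h
    rw [Finset.eq_univ_iff_forall.2 h, Finset.card_univ, Fintype.card_fin] at hτ
    omega
  have hσ : koszulDifferential x (fun σ => (u σ : MvPolynomial (Fin n) K)) (insert j τ) =
      koszulDifferential x e (insert j τ) :=
    (koszulDifferential_map x I.subtype u (insert j τ)).trans
      (congrArg Subtype.val (congrFun hu (insert j τ)))
  have hright : koszulDifferential x e (insert j τ) =
      koszulSign _ j (insert j τ) * ∏ i ∈ insert j τ, x i := by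
    rw [koszulDifferential_apply, Finset.sum_eq_single j]
    · rw [Finset.erase_insert hj, smul_comm, smul_eq_mul, smul_eq_mul, Finset.prod_insert hj,
        show e τ = ∏ i ∈ τ, x i from Pi.single_eq_same _ _]
    · intro i hi hij
      rw [he, smul_zero, smul_zero]
      rintro h
      exact hj (h ▸ Finset.mem_erase.2 ⟨hij.symm, Finset.mem_insert_self j τ⟩)
    · exact fun h => absurd (Finset.mem_insert_self j τ) h
  have hprod : ∏ i ∈ insert j τ, x i = ∑ i ∈ insert j τ, x i *
      (koszulSign _ j (insert j τ) * (koszulSign _ i (insert j τ) *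
        (u ((insert j τ).erase i) : MvPolynomial (Fin n) K))) := by
    rw [← one_mul (∏ i ∈ insert j τ, x i), ← koszulSign_mul_self j (insert j τ), mul_assoc,
      ← hright, ← hσ, koszulDifferential_apply, Finset.mul_sum]
    exact Finset.sum_congr rfl fun i _ => by rw [smul_eq_mul, smul_eq_mul, mul_left_comm]
  have hcoeff := congrArg (MvPolynomial.coeff (∑ i ∈ insert j τ, Finsupp.single i 1)) hprod
  rw [MvPolynomial.coeff_sum, Finset.sum_eq_zero fun i _ => hI.coeff_X_mul_eq_zero
    (I.mul_mem_left _ (I.mul_mem_left _ (u _).2)) i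
    (by rw [degree_sum_single, Finset.card_insert_of_notMem hj, hτ]),
    MvPolynomial.prod_X_eq_monomial, MvPolynomial.coeff_monomial, if_pos rfl] at hcoeff
  exact one_ne_zero hcoeff

end SquarefreeMonomials

/-! ### Counting and conclusion -/

open Finset in
/-- A family of `k + 1`-subsets of a finite set missing fewer than `(k + 1)⁻¹ * C(n, k)` of them
contains all the `k + 1`-supersets of some `k`-set. -/
theorem Finset.exists_forall_insert_of_card_mul_lt {α : Type*} [Fintype α] [DecidableEq α] {k : ℕ}
    (p : Finset α → Prop) [DecidablePred p]
    (h : #{σ ∈ powersetCard (k + 1) (univ : Finset α) | ¬ p σ} * (k + 1) <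
      (Fintype.card α).choose k) :
    ∃ τ : Finset α, #τ = k ∧ ∀ j ∉ τ, p (insert j τ) := by
  by_contra! hne
  refine h.not_ge ?_
  have hsub : powersetCard k (univ : Finset α) ⊆
      ({σ ∈ powersetCard (k + 1) (univ : Finset α) | ¬ p σ}).biUnion (powersetCard k) := by
    intro τ hτ
    obtain ⟨j, hj, hp⟩ := hne τ (mem_powersetCard.1 hτ).2
    simp only [mem_biUnion, mem_filter, mem_powersetCard]
    exact ⟨insert j τ, ⟨⟨subset_univ _, by
      rw [card_insert_of_notMem hj, (mem_powersetCard.1 hτ).2]⟩, hp⟩, subset_insert _ _,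
      (mem_powersetCard.1 hτ).2⟩
  calc (Fintype.card α).choose k = #(powersetCard k (univ : Finset α)) := by
        rw [card_powersetCard, card_univ]
    _ ≤ _ := card_le_card hsub
    _ ≤ _ := card_biUnion_le_card_mul _ _ _ fun σ hσ => by
        rw [card_powersetCard, (mem_powersetCard.1 (mem_filter.1 hσ).1).2, Nat.choose_succ_self_right]

theorem proposition1 {K : Type*} [Field K] (n d : ℕ) (hd : 0 < d)
    (I : Ideal (MvPolynomial (Fin n) K))
    (hI : IsGeneratedBySquarefreeMonomialsOfDegreeGE I d)
    (hρ : ((n : ℚ) - d) / ((n : ℚ) - d + 1) * (n.choose d : ℚ) <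
      (squarefreeMonomialCount I d : ℚ)) :
    polyDepth (K := K) (n := n) I ≤ (d : ℕ∞) := by
  classical
  obtain ⟨k, rfl⟩ : ∃ k, d = k + 1 := ⟨d - 1, by omega⟩
  let A : Finset (Finset (Fin n)) := (Finset.powersetCard (k + 1) Finset.univ).filter
    fun σ => (∏ i ∈ σ, MvPolynomial.X i : MvPolynomial (Fin n) K) ∈ I
  let B : Finset (Finset (Fin n)) := (Finset.powersetCard (k + 1) Finset.univ).filter
    fun σ => (∏ i ∈ σ, MvPolynomial.X i : MvPolynomial (Fin n) K) ∉ I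
  have hA : squarefreeMonomialCount I (k + 1) ≤ A.card := by
    rw [squarefreeMonomialCount]
    let T : Finset (MvPolynomial (Fin n) K) := A.image fun σ => ∏ i ∈ σ, MvPolynomial.X i
    refine (Set.ncard_le_ncard (t := (T : Set (MvPolynomial (Fin n) K))) ?_
      T.finite_toSet).trans ?_
    · rintro _ ⟨⟨σ, hσ, rfl⟩, hmem⟩
      exact Finset.mem_coe.2 (Finset.mem_image_of_mem _ (Finset.mem_filter.2
        ⟨Finset.mem_powersetCard.2 ⟨Finset.subset_univ _, hσ⟩, hmem⟩))
    · rw [Set.ncard_coe_finset]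
      exact Finset.card_image_le
  have hAB : A.card + B.card = n.choose (k + 1) := by
    rw [Finset.card_filter_add_card_filter_not, Finset.card_powersetCard, Finset.card_univ,
      Fintype.card_fin]
  -- For d > n both sides of the strict inequality `hρ` would be zero.
  have hkn : k + 1 ≤ n := by
    by_contra! hlt
    rw [Nat.choose_eq_zero_of_lt hlt] at hρ hAB
    have h0 : squarefreeMonomialCount I (k + 1) = 0 := by omega
    simp [h0] at hρ
  obtain ⟨c, rfl⟩ := Nat.exists_eq_add_of_le hkn
  have hB : B.card * (k + 1) < (k + 1 + c).choose k := by
    have hch : (k + 1 + c).choose (k + 1) * (k + 1) = (k + 1 + c).choose k * (c + 1) := by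
      rw [Nat.choose_succ_right_eq]
      congr 1
      omega
    have hlt : c * (k + 1 + c).choose (k + 1) < A.card * (c + 1) := by
      have hA' : (squarefreeMonomialCount I (k + 1) : ℚ) ≤ A.card := by exact_mod_cast hA
      have h := hρ.trans_le hA'
      have hc : ((k + 1 + c : ℕ) : ℚ) - ((k + 1 : ℕ) : ℚ) = c := by push_cast; ring
      rw [hc, div_mul_eq_mul_div, div_lt_iff₀ (by positivity)] at h
      exact_mod_cast h
    -- Here c = n-d. Multiplying by `k + 1` and using `hch`, the factor `c + 1` cancels.
    have hBlt : B.card * (c + 1) < (k + 1 + c).choose (k + 1) := by nlinarith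
    nlinarith
  obtain ⟨τ, hτ, hmem⟩ := Finset.exists_forall_insert_of_card_mul_lt (k := k)
    (fun σ : Finset (Fin (k + 1 + c)) =>
      (∏ i ∈ σ, MvPolynomial.X i : MvPolynomial (Fin (k + 1 + c)) K) ∈ I)
    (by rwa [Fintype.card_fin])
  exact polyDepth_le_of_forall_prod_insert_mem hI (by rw [hτ]) hkn hmem
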